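/- Let $n\ge 2$ and let $\Omega\subset\mathbb{C}^n$ be a bounded convex domain (a nonempty open set) with $C^\infty$-smooth boundary. Let $\phi=(\phi_1,\dots,\phi_n):\Omega\to\Omega$ be a holomorphic map all of whose components are $C^1$-smooth up to the boundary, that is, $\phi_j\in C^1(\overline\Omega)$ for $j=1,\dots,n$. Let $A^2(\Omega)$ be the Bergman space of all holomorphic functions $f:\Omega\to\mathbb{C}$ with $\|f\|^2=\int_\Omega |f|^2\,dV<\infty$, where $V$ is Lebesgue measure, and let $C_\phi f=f\circ\phi$ for $f\in A^2(\Omega)$. If $\phi:\Omega\to\Omega$ is proper and surjective, then $C_\phi$ is not compact on $A^2(\Omega)$; that is, it is not the case that $C_\phi$ maps $A^2(\Omega)$ into itself and is a compact linear operator there. -/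

import Mathlib

open MeasureTheory Set Topology
open scoped ContDiff

noncomputable section

namespace CompOp

/-- `ℂⁿ`, with the product topology and Lebesgue measure as `volume`. Only the topology, the
linear structure and Lebesgue measure are used below, so the choice of norm is immaterial. -/
abbrev Cn (n : ℕ) : Type := Fin n → ℂ

variable {n : ℕ}

/-- `Ω` has a `C^∞`-smooth boundary: near every boundary point `p` it is `{ρ < 0}` for a
real-valued `C^∞` function `ρ` with `dρ(p) ≠ 0`. -/
def HasSmoothBoundary (Ω : Set (Cn n)) : Prop :=
  ∀ p ∈ frontier Ω, ∃ (U : Set (Cn n)) (ρ : Cn n → ℝ),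
    IsOpen U ∧ p ∈ U ∧ ContDiffOn ℝ ∞ ρ U ∧ fderiv ℝ ρ p ≠ 0 ∧ Ω ∩ U = {z ∈ U | ρ z < 0}

/-- The Bergman space `A²(Ω)`: the elements of `L²(Ω)` that are (represented by) functions
holomorphic on `Ω`, with the norm of `L²(Ω)`. -/
def bergmanSpace (Ω : Set (Cn n)) : Submodule ℂ (Lp ℂ 2 (volume.restrict Ω)) where
  carrier := {f | ∃ g : Cn n → ℂ, DifferentiableOn ℂ g Ω ∧ f =ᵐ[volume.restrict Ω] g}
  add_mem' := by
    rintro f₁ f₂ ⟨g₁, hg₁, h₁⟩ ⟨g₂, hg₂, h₂⟩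
    exact ⟨g₁ + g₂, hg₁.add hg₂, (Lp.coeFn_add f₁ f₂).trans (h₁.add h₂)⟩
  zero_mem' := ⟨0, differentiableOn_const 0, Lp.coeFn_zero _ _ _⟩
  smul_mem' := by
    rintro c f ⟨g, hg, h⟩
    exact ⟨c • g, hg.const_smul c, (Lp.coeFn_smul c f).trans (h.const_smul c)⟩

variable {Ω : Set (Cn n)}

/-- The holomorphic function on `Ω` that an element of `A²(Ω)` is. Its values on `Ω` are uniquely
determined when `Ω` is open (`holo_eqOn`); its values off `Ω` are irrelevant. -/
def holo (f : bergmanSpace Ω) : Cn n → ℂ := f.2.choose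

theorem holo_differentiableOn (f : bergmanSpace Ω) : DifferentiableOn ℂ (holo f) Ω :=
  f.2.choose_spec.1

theorem holo_ae_eq (f : bergmanSpace Ω) :
    (f : Lp ℂ 2 (volume.restrict Ω)) =ᵐ[volume.restrict Ω] holo f :=
  f.2.choose_spec.2

theorem holo_eqOn (hΩ : IsOpen Ω) (f : bergmanSpace Ω) {g : Cn n → ℂ}
    (hg : DifferentiableOn ℂ g Ω)
    (hfg : (f : Lp ℂ 2 (volume.restrict Ω)) =ᵐ[volume.restrict Ω] g) : EqOn (holo f) g Ω :=
  Measure.eqOn_open_of_ae_eq ((holo_ae_eq f).symm.trans hfg) hΩ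
    (holo_differentiableOn f).continuousOn hg.continuousOn

/-- `f ∘ φ` is square integrable on `Ω` for every `f ∈ A²(Ω)`, that is, for a holomorphic self-map
`φ` of `Ω`, the composition operator `C_φ` maps `A²(Ω)` into `A²(Ω)`. -/
def ComposesBergman (Ω : Set (Cn n)) (φ : Cn n → Cn n) : Prop :=
  ∀ f : bergmanSpace Ω, MemLp (holo f ∘ φ) 2 (volume.restrict Ω)

/-- The composition operator `C_φ f = f ∘ φ` on `A²(Ω)`, for a holomorphic self-map `φ` of the open
set `Ω` such that `f ∘ φ ∈ A²(Ω)` for all `f ∈ A²(Ω)`. -/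
def compositionOperator {φ : Cn n → Cn n} (hΩ : IsOpen Ω) (hφ : DifferentiableOn ℂ φ Ω)
    (hmaps : MapsTo φ Ω Ω) (h : ComposesBergman Ω φ) : bergmanSpace Ω →ₗ[ℂ] bergmanSpace Ω where
  toFun f := ⟨(h f).toLp (holo f ∘ φ),
    holo f ∘ φ, (holo_differentiableOn f).comp hφ hmaps, (h f).coeFn_toLp⟩
  map_add' f₁ f₂ := by
    refine Subtype.ext ?_
    change (h (f₁ + f₂)).toLp _ = (h f₁).toLp _ + (h f₂).toLp _
    rw [← MemLp.toLp_add, MemLp.toLp_eq_toLp_iff]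
    have key : EqOn (holo (f₁ + f₂)) (holo f₁ + holo f₂) Ω :=
      holo_eqOn hΩ _ ((holo_differentiableOn f₁).add (holo_differentiableOn f₂))
        ((Lp.coeFn_add _ _).trans ((holo_ae_eq f₁).add (holo_ae_eq f₂)))
    exact (ae_restrict_mem hΩ.measurableSet).mono fun z hz => key (hmaps hz)
  map_smul' c f := by
    refine Subtype.ext ?_
    change (h (c • f)).toLp _ = c • (h f).toLp _
    rw [← MemLp.toLp_const_smul, MemLp.toLp_eq_toLp_iff]
    have key : EqOn (holo (c • f)) (c • holo f) Ω :=
      holo_eqOn hΩ _ ((holo_differentiableOn f).const_smul c)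
        ((Lp.coeFn_smul _ _).trans ((holo_ae_eq f).const_smul c))
    exact (ae_restrict_mem hΩ.measurableSet).mono fun z hz => key (hmaps hz)

end CompOp

end

namespace CompOp

open scoped ENNReal NNReal Polynomial

/-! Since `φ` is `C¹` on the compact set `closure Ω`, its real Jacobian determinant is bounded by
some `M`. As `φ` maps onto `Ω`, the change of variables inequality gives `∫_Ω |f|² ≤ M ∫_Ω |f ∘
φ|²`, so `C_φ` is bounded below (`exists_norm_le_mul_norm_compositionOperator`). A compact operator
bounded below has a finite-dimensional domain, whereas `A²(Ω)` contains all polynomials in one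
coordinate. -/

/-- A compact operator that is bounded below has a finite-dimensional domain. -/
theorem finiteDimensional_of_isCompactOperator_of_le_norm {E F : Type*}
    [NormedAddCommGroup E] [NormedSpace ℂ E] [NormedAddCommGroup F] [NormedSpace ℂ F]
    {T : E →ₗ[ℂ] F} (hT : IsCompactOperator T) {C : ℝ} (hC : ∀ x, ‖x‖ ≤ C * ‖T x‖) :
    FiniteDimensional ℂ E := by
  by_contra hE
  obtain ⟨R, u, -, hu, hsep⟩ := exists_seq_norm_le_one_le_norm_sub (𝕜 := ℂ) hE
  -- The bounded, 1-separated sequence `u` comes from Riesz's lemma. Being bounded below, `T` keeps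
  -- its images apart, so they have no Cauchy subsequence.
  obtain ⟨K, hK, hTK⟩ := hT.image_closedBall_subset_compact R
  obtain ⟨a, -, ψ, hψ, hlim⟩ := hK.tendsto_subseq (x := fun k => T (u k))
    fun k => hTK ⟨u k, by simpa using hu k, rfl⟩
  have hdist := hlim.cauchySeq
  rw [Metric.cauchySeq_iff] at hdist
  -- The `+ 1` keeps the denominator positive, as `C` is an arbitrary real.
  obtain ⟨N, hN⟩ := hdist (1 / (|C| + 1)) (by positivity)
  have h1 := hN N le_rfl (N + 1) (Nat.le_succ N)
  have h2 := hsep (hψ (Nat.lt_succ_self N)).ne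
  have h3 := hC (u (ψ N) - u (ψ (N + 1)))
  simp only [Function.comp_apply, dist_eq_norm, ← map_sub] at h1
  rw [lt_div_iff₀ (by positivity)] at h1
  have h4 := mul_le_mul_of_nonneg_right (le_abs_self C)
    (norm_nonneg (T (u (ψ N) - u (ψ (N + 1)))))
  have h5 := norm_nonneg (T (u (ψ N) - u (ψ (N + 1))))
  simp only [Nat.succ_eq_add_one] at h2
  linarith

/-- If the Jacobian determinant of `φ` is bounded by `M` on `Ω`, then Lebesgue measure on `φ(Ω)` is
at most `M` times the push-forward under `φ` of Lebesgue measure on `Ω`. -/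
theorem restrict_image_le_smul_map {E : Type*} [NormedAddCommGroup E] [NormedSpace ℝ E]
    [FiniteDimensional ℝ E] [MeasurableSpace E] [BorelSpace E] (μ : Measure E)
    [μ.IsAddHaarMeasure] {Ω : Set E} (hΩ : MeasurableSet Ω) {φ : E → E} {φ' : E → E →L[ℝ] E}
    (hφ : ∀ x ∈ Ω, HasFDerivWithinAt φ (φ' x) Ω x) {M : ℝ≥0} (hM : ∀ x ∈ Ω, |(φ' x).det| ≤ M) :
    μ.restrict (φ '' Ω) ≤ (M : ℝ≥0∞) • (μ.restrict Ω).map φ := by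
  have hcont : ContinuousOn φ Ω := fun x hx => (hφ x hx).continuousWithinAt
  refine Measure.le_iff.2 fun A hA => ?_
  have hmeas : MeasurableSet (Ω ∩ φ ⁻¹' A) := by
    have h := hΩ.subtype_image (hcont.domRestrict.measurable hA)
    rwa [domRestrict_eq, preimage_comp, Subtype.image_preimage_coe] at h
  calc μ.restrict (φ '' Ω) A = μ (φ '' (Ω ∩ φ ⁻¹' A)) := by
        rw [Measure.restrict_apply hA, image_inter_preimage, inter_comm]
    -- This inequality needs no injectivity: points with several preimages only enlarge the right
    -- side.
    _ ≤ ∫⁻ x in Ω ∩ φ ⁻¹' A, ENNReal.ofReal |(φ' x).det| ∂μ :=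
        addHaar_image_le_lintegral_abs_det_fderiv μ hmeas
          fun x hx => (hφ x hx.1).mono inter_subset_left
    _ ≤ ∫⁻ _ in Ω ∩ φ ⁻¹' A, (M : ℝ≥0∞) ∂μ :=
        setLIntegral_mono measurable_const fun x hx => by
          simpa using ENNReal.ofReal_le_ofReal (hM x hx.1)
    _ = ((M : ℝ≥0∞) • (μ.restrict Ω).map φ) A := by
        rw [setLIntegral_const, Measure.smul_apply, smul_eq_mul,
          Measure.map_apply_of_aemeasurable (hcont.aemeasurable hΩ) hA,
          Measure.restrict_apply' hΩ, inter_comm]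

/-- A map that is `C¹` on the compact closure of a convex open set has bounded Jacobian
determinant there. -/
theorem exists_abs_det_fderivWithin_le {E : Type*} [NormedAddCommGroup E] [NormedSpace ℝ E]
    [FiniteDimensional ℝ E] {Ω : Set E} (ho : IsOpen Ω) (hne : Ω.Nonempty)
    (hb : Bornology.IsBounded Ω) (hc : Convex ℝ Ω) {φ : E → E}
    (hφ : ContDiffOn ℝ 1 φ (closure Ω)) :
    ∃ M : ℝ≥0, ∀ x ∈ Ω, |(fderivWithin ℝ φ (closure Ω) x).det| ≤ M := by
  -- Convexity and nonempty interior make derivatives within the closure unique, hence continuous up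
  -- to the boundary.
  have hud : UniqueDiffOn ℝ (closure Ω) := uniqueDiffOn_convex hc.closure
    (hne.mono (interior_maximal subset_closure ho))
  have hcont : ContinuousOn (fun x => |(fderivWithin ℝ φ (closure Ω) x).det|) (closure Ω) :=
    (ContinuousLinearMap.continuous_det.comp_continuousOn
      (hφ.continuousOn_fderivWithin hud le_rfl)).abs
  obtain ⟨M, hM⟩ := hb.isCompact_closure.bddAbove_image hcont
  exact ⟨M.toNNReal, fun x hx =>
    (hM ⟨x, subset_closure hx, rfl⟩).trans (Real.le_coe_toNNReal M)⟩

variable {n : ℕ} {Ω : Set (Cn n)}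

/-- If `φ` is surjective with bounded Jacobian determinant, then `C_φ` is bounded below. -/
theorem exists_norm_le_mul_norm_compositionOperator {φ : Cn n → Cn n} (hΩ : IsOpen Ω)
    (hφ : DifferentiableOn ℂ φ Ω) (hmaps : MapsTo φ Ω Ω) (h : ComposesBergman Ω φ)
    (hsurj : SurjOn φ Ω Ω) {φ' : Cn n → Cn n →L[ℝ] Cn n}
    (hφ' : ∀ x ∈ Ω, HasFDerivWithinAt φ (φ' x) Ω x) {M : ℝ≥0} (hM : ∀ x ∈ Ω, |(φ' x).det| ≤ M) :
    ∃ C : ℝ, ∀ f, ‖f‖ ≤ C * ‖compositionOperator hΩ hφ hmaps h f‖ := by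
  have hle := restrict_image_le_smul_map volume hΩ.measurableSet hφ' hM
  rw [hsurj.image_eq_of_mapsTo hmaps] at hle
  -- `holo f` is controlled only on `Ω`; its measurability for the push-forward requires that
  -- measure to be carried by `Ω`.
  have hcarrier : ((volume.restrict Ω).map φ).restrict Ω = (volume.restrict Ω).map φ := by
    refine Measure.restrict_eq_self_of_ae_mem ?_
    refine (ae_map_iff (hφ.continuousOn.aemeasurable hΩ.measurableSet) hΩ.measurableSet).2 ?_
    exact (ae_restrict_mem hΩ.measurableSet).mono hmaps
  -- The constant is `√M`, since the norm is that of `L²`.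
  refine ⟨((M : ℝ≥0∞) ^ (1 / 2 : ℝ≥0∞).toReal).toReal, fun f => ?_⟩
  have hmeas : AEStronglyMeasurable (holo f) ((volume.restrict Ω).map φ) := by
    rw [← hcarrier]
    exact (holo_differentiableOn f).continuousOn.aestronglyMeasurable hΩ.measurableSet
  have key : eLpNorm (holo f) 2 (volume.restrict Ω) ≤
      (M : ℝ≥0∞) ^ (1 / 2 : ℝ≥0∞).toReal * eLpNorm (holo f ∘ φ) 2 (volume.restrict Ω) := by
    refine (eLpNorm_mono_measure _ hle).trans_eq ?_
    rw [eLpNorm_smul_measure_of_ne_top ENNReal.ofNat_ne_top, smul_eq_mul,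
      eLpNorm_map_measure hmeas (hφ.continuousOn.aemeasurable hΩ.measurableSet)]
  change ‖(f : Lp ℂ 2 (volume.restrict Ω))‖ ≤ _ * ‖(h f).toLp (holo f ∘ φ)‖
  rw [Lp.norm_toLp, Lp.norm_def, eLpNorm_congr_ae (holo_ae_eq f), ← ENNReal.toReal_mul]
  exact ENNReal.toReal_mono
    (ENNReal.mul_ne_top (ENNReal.rpow_ne_top_of_nonneg ENNReal.toReal_nonneg ENNReal.coe_ne_top)
      (h f).eLpNorm_ne_top) key

theorem memLp_polynomial_comp_apply (hb : Bornology.IsBounded Ω) (i : Fin n) (p : ℂ[X]) :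
    MemLp (fun z : Cn n => p.eval (z i)) 2 (volume.restrict Ω) := by
  have hcont : Continuous fun z : Cn n => p.eval (z i) := by fun_prop
  obtain ⟨C, hC⟩ := hb.isCompact_closure.exists_bound_of_continuousOn hcont.continuousOn
  have : IsFiniteMeasure (volume.restrict Ω) := ⟨by simpa using hb.measure_lt_top⟩
  have hbound : ∀ᵐ z ∂(volume.restrict Ω), ‖p.eval (z i)‖ ≤ C :=
    ae_restrict_of_ae_restrict_of_subset subset_closure
      ((ae_restrict_mem isClosed_closure.measurableSet).mono hC)
  exact MemLp.of_bound hcont.aestronglyMeasurable C hbound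

/-- Polynomials in the `i`-th coordinate, as elements of the Bergman space of a bounded set. -/
noncomputable def bergmanPolynomial (hb : Bornology.IsBounded Ω) (i : Fin n) : ℂ[X] →ₗ[ℂ] bergmanSpace Ω where
  toFun p := ⟨(memLp_polynomial_comp_apply hb i p).toLp _, fun z => p.eval (z i),
    by fun_prop, MemLp.coeFn_toLp _⟩
  map_add' p q := by
    refine Subtype.ext ?_
    change (memLp_polynomial_comp_apply hb i (p + q)).toLp _ =
      (memLp_polynomial_comp_apply hb i p).toLp _ + (memLp_polynomial_comp_apply hb i q).toLp _
    rw [← MemLp.toLp_add, MemLp.toLp_eq_toLp_iff]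
    exact .of_forall fun z => by simp
  map_smul' c p := by
    refine Subtype.ext ?_
    change (memLp_polynomial_comp_apply hb i (c • p)).toLp _ =
      c • (memLp_polynomial_comp_apply hb i p).toLp _
    rw [← MemLp.toLp_const_smul, MemLp.toLp_eq_toLp_iff]
    exact .of_forall fun z => by simp

/-- Coordinate projections are open, so the `i`-th coordinate takes infinitely many values on `Ω`,
and these determine a polynomial. -/
theorem bergmanPolynomial_injective (ho : IsOpen Ω) (hne : Ω.Nonempty)
    (hb : Bornology.IsBounded Ω) (i : Fin n) : Function.Injective (bergmanPolynomial hb i) := by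
  intro p q hpq
  have hae : (fun z : Cn n => p.eval (z i)) =ᵐ[volume.restrict Ω] fun z => q.eval (z i) :=
    (MemLp.toLp_eq_toLp_iff (memLp_polynomial_comp_apply hb i p)
      (memLp_polynomial_comp_apply hb i q)).1 (congrArg Subtype.val hpq)
  have heq : EqOn (fun z : Cn n => p.eval (z i)) (fun z => q.eval (z i)) Ω :=
    Measure.eqOn_open_of_ae_eq hae ho (by fun_prop) (by fun_prop)
  refine Polynomial.eq_of_infinite_eval_eq p q (Infinite.mono (s := Function.eval i '' Ω) ?_ ?_)
  · rintro _ ⟨z, hz, rfl⟩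
    exact heq hz
  · obtain ⟨z, hz⟩ := hne
    exact infinite_of_mem_nhds (z i) ((isOpenMap_eval i Ω ho).mem_nhds ⟨z, hz, rfl⟩)

/-- In positive dimension the Bergman space of a bounded nonempty open set is
infinite-dimensional. -/
theorem not_finiteDimensional_bergmanSpace (ho : IsOpen Ω) (hne : Ω.Nonempty)
    (hb : Bornology.IsBounded Ω) (hn : 0 < n) : ¬ FiniteDimensional ℂ (bergmanSpace Ω) :=
  fun _ => Polynomial.not_finite (R := ℂ) <|
    Module.Finite.of_injective _ (bergmanPolynomial_injective ho hne hb ⟨0, hn⟩)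

end CompOp

/- A bounded convex domain with smooth boundary and a holomorphic self-map `φ` of it that is `C¹` on
the closure (the values of `φ` on the boundary are those of the `C¹` extension). If `φ` is proper
and surjective as a map `Ω → Ω`, it is not the case that `C_φ` maps `A²(Ω)` to itself and is
compact. -/
theorem corollary2 (n : ℕ) (hn : 2 ≤ n) (Ω : Set (CompOp.Cn n))
    (hΩ_open : IsOpen Ω) (hΩ_nonempty : Ω.Nonempty) (hΩ_bounded : Bornology.IsBounded Ω)
    (hΩ_convex : Convex ℝ Ω) (hΩ_smooth : CompOp.HasSmoothBoundary Ω)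
    (φ : CompOp.Cn n → CompOp.Cn n) (hφ_maps : Set.MapsTo φ Ω Ω)
    (hφ_holo : DifferentiableOn ℂ φ Ω) (hφ_C1 : ContDiffOn ℝ 1 φ (closure Ω))
    (hφ_proper : IsProperMap (Set.MapsTo.restrict φ Ω Ω hφ_maps))
    (hφ_surj : Function.Surjective (Set.MapsTo.restrict φ Ω Ω hφ_maps)) :
    ¬ ∃ h : CompOp.ComposesBergman Ω φ,
        IsCompactOperator (CompOp.compositionOperator hΩ_open hφ_holo hφ_maps h) := by
  rintro ⟨h, hcomp⟩
  obtain ⟨M, hM⟩ := CompOp.exists_abs_det_fderivWithin_le hΩ_open hΩ_nonempty hΩ_bounded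
    hΩ_convex hφ_C1
  have hsurj : SurjOn φ Ω Ω := MapsTo.restrict_surjective_iff hφ_maps |>.1 hφ_surj
  obtain ⟨C, hC⟩ := CompOp.exists_norm_le_mul_norm_compositionOperator hΩ_open hφ_holo hφ_maps h
    hsurj (fun x hx => ((hφ_C1.differentiableOn one_ne_zero x
      (subset_closure hx)).hasFDerivWithinAt).mono subset_closure) hM
  exact CompOp.not_finiteDimensional_bergmanSpace hΩ_open hΩ_nonempty hΩ_bounded (by omega)
    (CompOp.finiteDimensional_of_isCompactOperator_of_le_norm hcomp hC)
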